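/- For complex $a,q$ with $|q|<1$ write $(a)_n=\prod_{k=0}^{n-1}(1-aq^k)$ for $n\ge 0$ and $(a)_\infty=\prod_{k=0}^{\infty}(1-aq^k)$. Let $\alpha,\beta,q\in\mathbb{C}$ with $|\alpha|<1$ and $|q|<1$, and suppose that $\beta q^n\neq 1$ for all $n\ge 1$ (so that no denominator vanishes). Then $$\sum_{n=0}^{\infty}\frac{1}{(\beta q)_n(q)_n}\bigl((\alpha)_n-(\alpha)_\infty\bigr)=\frac{(\alpha)_\infty}{(q)_\infty}\left[\sum_{n=1}^{\infty}\frac{n\beta^nq^{n^2}}{(\beta q)_n(q)_n}+\frac{1}{(\beta q)_\infty}\sum_{n=1}^{\infty}\frac{(\beta q/\alpha)_n}{1-q^n}\alpha^n\right],$$ where all three series converge absolutely; for $\alpha=0$ the expression $(\beta q/\alpha)_n\alpha^n$ is understood as its limit as $\alpha\to 0$, namely $(-\beta)^nq^{n(n+1)/2}$. -/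

import Mathlib

/-- The finite `q`-shifted factorial `(a)_n = (a; q)_n = ∏_{k=0}^{n-1} (1 - a q^k)`. -/
def qPoch (a q : ℂ) (n : ℕ) : ℂ := ∏ k ∈ Finset.range n, (1 - a * q ^ k)

/-- The infinite `q`-shifted factorial `(a)_∞ = (a; q)_∞ = ∏_{k≥0} (1 - a q^k)`. The product
converges unconditionally for every `a` when `‖q‖ < 1`, see `qPochInf_hasProd`. -/
noncomputable def qPochInf (a q : ℂ) : ℂ := ∏' k : ℕ, (1 - a * q ^ k)

/-- For `‖q‖ < 1` the infinite product converges, so that `qPochInf` is its genuine value. -/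
theorem qPochInf_hasProd (a : ℂ) {q : ℂ} (hq : ‖q‖ < 1) :
    HasProd (fun k : ℕ => 1 - a * q ^ k) (qPochInf a q) := by
  have h : Summable fun k : ℕ => ‖-(a * q ^ k)‖ := by
    simp only [norm_neg, norm_mul, norm_pow]
    exact (summable_geometric_of_lt_one (norm_nonneg q) hq).mul_left _
  have hm := (multipliable_one_add_of_summable h).hasProd
  simp only [← sub_eq_add_neg] at hm
  exact hm

/-!
The proof rests on Euler's two expansions, valid for `‖q‖ < 1`:
`1 / (x)_∞ = ∑ x^m / (q)_m` for `‖x‖ < 1` (`hasSum_eulerInvTerm`) and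
`(y)_∞ = ∑ (-y)^j q^(j(j-1)/2) / (q)_j` for every `y` (`hasSum_eulerTerm`).

Since `(α)_n = (α)_∞ / (αq^n)_∞` and `1 / (βq)_n = (βq^(n+1))_∞ / (βq)_∞`, they expand the `n`-th
term of the left-hand side into a double series over `m ≥ 1` and `j ≥ 0`
(`hasSum_qPoch_sub_qPochInf_term`), where `n` enters only through `q^(n(m+j)) / (q)_n`. The triple
series converges absolutely, and summing over `n` first gives
`1 / (q^(m+j))_∞ = (q)_(m+j-1) / (q)_∞`. On the diagonals `m + j = N` the finite `q`-binomial
theorem (`sum_antidiagonal_eulerInvTerm_mul_eulerTerm`) sums all terms with `m ≥ 0` to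
`∏_{k=1}^{N} (α - βq^k) / (1 - q^N)`, the summand `(βq/α)_N α^N / (1 - q^N)` of the claim. The
term `m = 0`, absent from the left-hand side, is `(-β)^N q^(N(N+1)/2) / (1 - q^N)`, and the
correction this makes is the series `∑ n β^n q^(n^2) / ((βq)_n (q)_n)`
(`hasSum_nat_mul_pow_mul_pow_sq`): expand `1 / (βq)_n` once more and differentiate the finite
`q`-binomial theorem at `t = 1`, where `(t)_N` has a simple zero.

The product `∏_{k=1}^{N} (α - βq^k)` is used throughout in place of `(βq/α)_N α^N`, so that
`α = 0` needs no separate argument.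
-/

open Filter Topology Finset

/-! ### Shifted factorials -/

theorem qPoch_zero (a q : ℂ) : qPoch a q 0 = 1 := by simp [qPoch]

theorem qPoch_succ (a q : ℂ) (n : ℕ) : qPoch a q (n + 1) = qPoch a q n * (1 - a * q ^ n) := by
  simp [qPoch, prod_range_succ]

theorem qPoch_add (a q : ℂ) (n m : ℕ) :
    qPoch a q (n + m) = qPoch a q n * qPoch (a * q ^ n) q m := by
  simp only [qPoch, prod_range_add, pow_add, mul_assoc]

theorem tendsto_qPoch (a : ℂ) {q : ℂ} (hq : ‖q‖ < 1) :
    Tendsto (qPoch a q) atTop (𝓝 (qPochInf a q)) :=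
  (qPochInf_hasProd a hq).tendsto_prod_nat

theorem qPoch_mul_qPochInf (a : ℂ) {q : ℂ} (hq : ‖q‖ < 1) (n : ℕ) :
    qPoch a q n * qPochInf (a * q ^ n) q = qPochInf a q := by
  have h1 := (tendsto_qPoch (a * q ^ n) hq).const_mul (qPoch a q n)
  have h2 := (tendsto_add_atTop_iff_nat n).2 (tendsto_qPoch a hq)
  refine tendsto_nhds_unique h1 (h2.congr fun m => ?_)
  rw [add_comm, qPoch_add]

theorem qPochInf_ne_zero {a q : ℂ} (hq : ‖q‖ < 1) (h : ∀ k : ℕ, a * q ^ k ≠ 1) :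
    qPochInf a q ≠ 0 := by
  have hs : Summable fun k : ℕ => ‖-(a * q ^ k)‖ := by
    simp only [norm_neg, norm_mul, norm_pow]
    exact (summable_geometric_of_lt_one (norm_nonneg q) hq).mul_left _
  have := tprod_one_add_ne_zero_of_summable (f := fun k : ℕ => -(a * q ^ k))
    (fun k => by rw [← sub_eq_add_neg]; exact sub_ne_zero.2 (h k).symm) hs
  simpa only [qPochInf, sub_eq_add_neg] using this

theorem mul_pow_ne_one {a q : ℂ} (hq : ‖q‖ < 1) (ha : ‖a‖ < 1) (k : ℕ) : a * q ^ k ≠ 1 := by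
  intro h
  have h1 : ‖a * q ^ k‖ < 1 := by
    rw [norm_mul, norm_pow]
    exact mul_lt_one_of_nonneg_of_lt_one_left (norm_nonneg a) ha
      (pow_le_one₀ (norm_nonneg q) hq.le)
  rw [h, norm_one] at h1
  exact lt_irrefl _ h1

theorem qPoch_ne_zero {a q : ℂ} (h : ∀ k : ℕ, a * q ^ k ≠ 1) (n : ℕ) : qPoch a q n ≠ 0 :=
  prod_ne_zero_iff.2 fun k _ => sub_ne_zero.2 (h k).symm

theorem qPoch_self_ne_zero {q : ℂ} (hq : ‖q‖ < 1) (n : ℕ) : qPoch q q n ≠ 0 :=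
  qPoch_ne_zero (mul_pow_ne_one hq hq) n

theorem one_sub_pow_succ_ne_zero {q : ℂ} (hq : ‖q‖ < 1) (n : ℕ) : 1 - q ^ (n + 1) ≠ 0 := by
  rw [pow_succ']
  exact sub_ne_zero.2 (mul_pow_ne_one hq hq n).symm

theorem exists_norm_inv_qPoch_le {a q : ℂ} (hq : ‖q‖ < 1) (h : ∀ k : ℕ, a * q ^ k ≠ 1) :
    ∃ C : ℝ, ∀ n, ‖(qPoch a q n)⁻¹‖ ≤ C := by
  have ht := ((tendsto_qPoch a hq).inv₀ (qPochInf_ne_zero hq h)).norm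
  obtain ⟨C, hC⟩ := ht.bddAbove_range
  exact ⟨C, fun n => hC ⟨n, rfl⟩⟩

/-! ### Euler's two expansions -/

/-- The coefficient family `x^m / (q)_m` of Euler's expansion of `1 / (x)_∞`. -/
noncomputable def eulerInvTerm (x q : ℂ) (m : ℕ) : ℂ := x ^ m / qPoch q q m

/-- The family `(-y)^j q^(j(j-1)/2) / (q)_j` of Euler's expansion of `(y)_∞`. -/
noncomputable def eulerTerm (y q : ℂ) (j : ℕ) : ℂ := (-y) ^ j * q ^ j.choose 2 / qPoch q q j

theorem eulerInvTerm_mul (x z q : ℂ) (m : ℕ) :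
    eulerInvTerm (x * z) q m = z ^ m * eulerInvTerm x q m := by
  simp only [eulerInvTerm, mul_pow]; ring

theorem eulerTerm_mul (y z q : ℂ) (j : ℕ) :
    eulerTerm (y * z) q j = z ^ j * eulerTerm y q j := by
  simp only [eulerTerm, ← neg_mul, mul_pow]; ring

theorem one_sub_pow_mul_eulerInvTerm_succ {q : ℂ} (hq : ‖q‖ < 1) (x : ℂ) (m : ℕ) :
    (1 - q ^ (m + 1)) * eulerInvTerm x q (m + 1) = x * eulerInvTerm x q m := by
  have h1 := one_sub_pow_succ_ne_zero hq m
  have h2 := qPoch_self_ne_zero hq m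
  rw [eulerInvTerm, eulerInvTerm, qPoch_succ, ← pow_succ']
  field_simp
  ring

theorem choose_two_succ (n : ℕ) : (n + 1).choose 2 = n + n.choose 2 := by
  rw [Nat.choose_succ_succ' n 1, Nat.choose_one_right]

theorem one_sub_pow_mul_eulerTerm_succ {q : ℂ} (hq : ‖q‖ < 1) (y : ℂ) (j : ℕ) :
    (1 - q ^ (j + 1)) * eulerTerm y q (j + 1) = -y * (q ^ j * eulerTerm y q j) := by
  have h1 := one_sub_pow_succ_ne_zero hq j
  have h2 := qPoch_self_ne_zero hq j
  rw [eulerTerm, eulerTerm, qPoch_succ, ← pow_succ', choose_two_succ]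
  field_simp
  ring

theorem summable_pow_mul_pow_choose_two (r : ℝ) {s : ℝ} (hr : 0 ≤ r) (hs0 : 0 ≤ s) (hs : s < 1) :
    Summable fun n : ℕ => r ^ n * s ^ n.choose 2 := by
  have ht : Tendsto (fun n : ℕ => r * s ^ n) atTop (𝓝 0) := by
    simpa using (tendsto_pow_atTop_nhds_zero_of_lt_one hs0 hs).const_mul r
  refine summable_of_ratio_norm_eventually_le (r := 1 / 2) (by norm_num) ?_
  filter_upwards [ht.eventually_le_const (show (0 : ℝ) < 1 / 2 by norm_num)] with n hn
  have e : r ^ (n + 1) * s ^ (n + 1).choose 2 = r * s ^ n * (r ^ n * s ^ n.choose 2) := by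
    rw [choose_two_succ]; ring
  rw [e, norm_mul, Real.norm_of_nonneg (by positivity : 0 ≤ r * s ^ n)]
  gcongr

theorem summable_norm_eulerInvTerm {x q : ℂ} (hx : ‖x‖ < 1) (hq : ‖q‖ < 1) :
    Summable fun m => ‖eulerInvTerm x q m‖ := by
  obtain ⟨C, hC⟩ := exists_norm_inv_qPoch_le hq (mul_pow_ne_one hq hq)
  refine Summable.of_nonneg_of_le (fun _ => norm_nonneg _) (fun m => ?_)
    ((summable_geometric_of_lt_one (norm_nonneg x) hx).mul_right C)
  rw [eulerInvTerm, div_eq_mul_inv, norm_mul, norm_pow]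
  gcongr
  exact hC m

theorem summable_norm_eulerTerm (y : ℂ) {q : ℂ} (hq : ‖q‖ < 1) :
    Summable fun j => ‖eulerTerm y q j‖ := by
  obtain ⟨C, hC⟩ := exists_norm_inv_qPoch_le hq (mul_pow_ne_one hq hq)
  refine Summable.of_nonneg_of_le (fun _ => norm_nonneg _) (fun m => ?_)
    ((summable_pow_mul_pow_choose_two ‖y‖ (norm_nonneg y) (norm_nonneg q) hq).mul_right C)
  rw [eulerTerm, div_eq_mul_inv, norm_mul, norm_mul, norm_pow, norm_pow, norm_neg]
  gcongr
  exact hC m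

/-- Continuity at the origin of an absolutely convergent power series, along `z = q^n`. -/
theorem tendsto_tsum_pow_mul {c : ℕ → ℂ} (hc : Summable fun j => ‖c j‖) {q : ℂ} (hq : ‖q‖ < 1) :
    Tendsto (fun n : ℕ => ∑' j, (q ^ n) ^ j * c j) atTop (𝓝 (c 0)) := by
  have h0 : ∑' j, (0 : ℂ) ^ j * c j = c 0 := by
    rw [tsum_eq_single 0 fun j hj => by simp [hj]]; simp
  rw [← h0]
  refine tendsto_tsum_of_dominated_convergence hc (fun j => ?_) (.of_forall fun n j => ?_)
  · exact ((tendsto_pow_atTop_nhds_zero_of_norm_lt_one hq).pow j).mul_const _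
  · rw [norm_mul, norm_pow, norm_pow]
    exact mul_le_of_le_one_left (norm_nonneg _)
      (pow_le_one₀ (by positivity) (pow_le_one₀ (norm_nonneg q) hq.le))

/-- Euler's expansion of `1 / (x)_∞`. Both sides satisfy `F (x q) = (1 - x) F x`; iterate and let
the argument tend to `0`. -/
theorem hasSum_eulerInvTerm {x q : ℂ} (hx : ‖x‖ < 1) (hq : ‖q‖ < 1) :
    HasSum (eulerInvTerm x q) (qPochInf x q)⁻¹ := by
  have hlt : ∀ n : ℕ, ‖x * q ^ n‖ < 1 := fun n => by
    rw [norm_mul, norm_pow]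
    exact mul_lt_one_of_nonneg_of_lt_one_left (norm_nonneg x) hx
      (pow_le_one₀ (norm_nonneg q) hq.le)
  have step : ∀ z : ℂ, ‖z‖ < 1 →
      ∑' m, eulerInvTerm (z * q) q m = (1 - z) * ∑' m, eulerInvTerm z q m := by
    intro z hz
    have hs := (summable_norm_eulerInvTerm hz hq).of_norm
    have hs' : Summable (fun m => q ^ m * eulerInvTerm z q m) := by
      simp only [← eulerInvTerm_mul]
      refine (summable_norm_eulerInvTerm ?_ hq).of_norm
      rw [norm_mul]
      exact mul_lt_one_of_nonneg_of_lt_one_left (norm_nonneg z) hz hq.le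
    have hd : ∑' m, (eulerInvTerm z q m - q ^ m * eulerInvTerm z q m)
        = z * ∑' m, eulerInvTerm z q m := by
      rw [(hs.sub hs').tsum_eq_zero_add, ← tsum_mul_left]
      simp only [pow_zero, one_mul, sub_self, zero_add]
      refine tsum_congr fun m => ?_
      rw [← one_sub_pow_mul_eulerInvTerm_succ hq z m]
      ring
    rw [hs.tsum_sub hs'] at hd
    simp only [eulerInvTerm_mul]
    linear_combination -hd
  have iter : ∀ n : ℕ, ∑' m, eulerInvTerm (x * q ^ n) q m
      = qPoch x q n * ∑' m, eulerInvTerm x q m := by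
    intro n
    induction n with
    | zero => simp [qPoch_zero]
    | succ n ih =>
      rw [pow_succ, ← mul_assoc, step _ (hlt n), ih, qPoch_succ]; ring
  have hs := summable_norm_eulerInvTerm hx hq
  have h1 : Tendsto (fun n : ℕ => ∑' m, eulerInvTerm (x * q ^ n) q m) atTop (𝓝 1) := by
    simp only [eulerInvTerm_mul]
    simpa [eulerInvTerm, qPoch_zero] using tendsto_tsum_pow_mul hs hq
  have h2 : 1 = qPochInf x q * ∑' m, eulerInvTerm x q m :=
    tendsto_nhds_unique h1 (((tendsto_qPoch x hq).mul_const _).congr fun n => (iter n).symm)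
  rw [← eq_inv_of_mul_eq_one_right h2.symm]
  exact hs.of_norm.hasSum

/-- Euler's expansion of `(y)_∞`. Both sides satisfy `G y = (1 - y) G (y q)`; iterate and let
the argument tend to `0`. -/
theorem hasSum_eulerTerm (y : ℂ) {q : ℂ} (hq : ‖q‖ < 1) :
    HasSum (eulerTerm y q) (qPochInf y q) := by
  have step : ∀ z : ℂ, ∑' j, eulerTerm z q j = (1 - z) * ∑' j, eulerTerm (z * q) q j := by
    intro z
    have hs := (summable_norm_eulerTerm z hq).of_norm
    have hs' : Summable (fun j => q ^ j * eulerTerm z q j) := by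
      simp only [← eulerTerm_mul]
      exact (summable_norm_eulerTerm _ hq).of_norm
    have hd : ∑' j, (eulerTerm z q j - q ^ j * eulerTerm z q j)
        = -z * ∑' j, q ^ j * eulerTerm z q j := by
      rw [(hs.sub hs').tsum_eq_zero_add, ← tsum_mul_left]
      simp only [pow_zero, one_mul, sub_self, zero_add]
      refine tsum_congr fun j => ?_
      rw [← one_sub_pow_mul_eulerTerm_succ hq z j]
      ring
    rw [hs.tsum_sub hs'] at hd
    simp only [eulerTerm_mul]
    linear_combination hd
  have iter : ∀ n : ℕ, ∑' j, eulerTerm y q j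
      = qPoch y q n * ∑' j, eulerTerm (y * q ^ n) q j := by
    intro n
    induction n with
    | zero => simp [qPoch_zero]
    | succ n ih =>
      rw [ih, step, qPoch_succ, pow_succ]; ring_nf
  have hs := summable_norm_eulerTerm y hq
  have h1 : Tendsto (fun n : ℕ => ∑' j, eulerTerm (y * q ^ n) q j) atTop (𝓝 1) := by
    simp only [eulerTerm_mul]
    simpa [eulerTerm, qPoch_zero] using tendsto_tsum_pow_mul hs hq
  have h2 : ∑' j, eulerTerm y q j = qPochInf y q * 1 :=
    tendsto_nhds_unique tendsto_const_nhds
      (((tendsto_qPoch y hq).mul h1).congr fun n => (iter n).symm)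
  rw [mul_one] at h2
  rw [← h2]
  exact hs.of_norm.hasSum

/-! ### The finite `q`-binomial theorem -/

/-- The `q`-binomial theorem, divided by `(q)_N` so that no Gaussian binomials are needed.
Multiplying the sum `S_N` by `1 - q^N = (1 - q^i) + q^i (1 - q^j)` yields
`(1 - q^N) S_N = (x - y q^(N-1)) S_(N-1)`. -/
theorem sum_antidiagonal_eulerInvTerm_mul_eulerTerm {q : ℂ} (hq : ‖q‖ < 1) (x y : ℂ) (N : ℕ) :
    ∑ p ∈ antidiagonal N, eulerInvTerm x q p.1 * eulerTerm y q p.2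
      = (∏ k ∈ range N, (x - y * q ^ k)) / qPoch q q N := by
  induction N with
  | zero => simp [eulerInvTerm, eulerTerm, qPoch_zero]
  | succ N ih =>
    have hN := one_sub_pow_succ_ne_zero hq N
    have hQ := qPoch_self_ne_zero hq N
    have key : (1 - q ^ (N + 1)) *
        ∑ p ∈ antidiagonal (N + 1), eulerInvTerm x q p.1 * eulerTerm y q p.2
        = (x - y * q ^ N) * ∑ p ∈ antidiagonal N, eulerInvTerm x q p.1 * eulerTerm y q p.2 := by
      have split : (1 - q ^ (N + 1)) *
          ∑ p ∈ antidiagonal (N + 1), eulerInvTerm x q p.1 * eulerTerm y q p.2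
          = ∑ p ∈ antidiagonal (N + 1),
              (1 - q ^ p.1) * eulerInvTerm x q p.1 * eulerTerm y q p.2
            + ∑ p ∈ antidiagonal (N + 1),
              q ^ p.1 * eulerInvTerm x q p.1 * ((1 - q ^ p.2) * eulerTerm y q p.2) := by
        rw [mul_sum, ← sum_add_distrib]
        refine sum_congr rfl fun p hp => ?_
        rw [← mem_antidiagonal.1 hp, pow_add]
        ring
      -- The boundary terms `i = 0` and `j = 0` vanish because of the factors `1 - q^i`, `1 - q^j`.
      rw [split, Nat.sum_antidiagonal_succ, Nat.sum_antidiagonal_succ']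
      simp only [pow_zero, sub_self, zero_mul, mul_zero, zero_add]
      rw [mul_sum, ← sum_add_distrib]
      refine sum_congr rfl fun p hp => ?_
      rw [one_sub_pow_mul_eulerInvTerm_succ hq, one_sub_pow_mul_eulerTerm_succ hq,
        ← mem_antidiagonal.1 hp]
      ring
    rw [ih] at key
    rw [qPoch_succ, prod_range_succ, ← pow_succ', eq_div_iff (mul_ne_zero hQ hN)]
    rw [mul_comm (qPoch q q N), ← mul_assoc, mul_comm _ (1 - q ^ (N + 1)), key]
    field_simp

/-- The derivative at `t = 1` of the `q`-binomial expansion of `(t)_(M+1)`, whose only factor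
vanishing at `t = 1` is `1 - t`. -/
theorem sum_antidiagonal_nat_mul {q : ℂ} (hq : ‖q‖ < 1) (M : ℕ) :
    ∑ p ∈ antidiagonal (M + 1),
      (p.1 : ℂ) * eulerTerm 1 q p.1 / qPoch q q p.2 = -1 / (1 - q ^ (M + 1)) := by
  have hbin : ∀ t : ℂ, ∑ p ∈ antidiagonal (M + 1), t ^ p.1 * (eulerTerm 1 q p.1 / qPoch q q p.2)
      = (∏ k ∈ range M, (1 - t * q ^ (k + 1))) * (1 - t) / qPoch q q (M + 1) := by
    intro t
    have h := sum_antidiagonal_eulerInvTerm_mul_eulerTerm hq 1 t (M + 1)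
    rw [prod_range_succ', pow_zero, mul_one] at h
    rw [← h, ← Nat.sum_antidiagonal_swap]
    refine sum_congr rfl fun p _ => ?_
    simp only [Prod.fst_swap, Prod.snd_swap]
    rw [← one_mul t, eulerTerm_mul, eulerInvTerm, one_pow, one_mul]
    ring
  have hl : HasDerivAt
      (fun t : ℂ => ∑ p ∈ antidiagonal (M + 1), t ^ p.1 * (eulerTerm 1 q p.1 / qPoch q q p.2))
      (∑ p ∈ antidiagonal (M + 1),
        ((p.1 : ℂ) * 1 ^ (p.1 - 1)) * (eulerTerm 1 q p.1 / qPoch q q p.2)) 1 :=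
    HasDerivAt.fun_sum fun p _ => (hasDerivAt_pow p.1 (1 : ℂ)).mul_const _
  have hg : DifferentiableAt ℂ (fun t : ℂ => ∏ k ∈ range M, (1 - t * q ^ (k + 1))) 1 := by
    fun_prop
  have hr := (hg.hasDerivAt.mul ((hasDerivAt_id (1 : ℂ)).const_sub 1)).div_const
    (qPoch q q (M + 1))
  have heq := hl.unique (hr.congr_of_eventuallyEq (.of_forall fun t => by simpa using hbin t))
  have hQ := qPoch_self_ne_zero hq M
  have hM := one_sub_pow_succ_ne_zero hq M
  have hval : ∏ k ∈ range M, (1 - 1 * q ^ (k + 1)) = qPoch q q M := by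
    simp only [qPoch, one_mul, pow_succ']
  simp only [id, sub_self, mul_zero, zero_add, one_pow, mul_one, hval] at heq
  simp only [mul_div_assoc]
  rw [heq, qPoch_succ, ← pow_succ']
  field_simp

/-! ### Rearrangement of multiple series -/

theorem hasSum_sum_antidiagonal {f : ℕ × ℕ → ℂ} {S : ℂ} (hf : HasSum f S) :
    HasSum (fun N => ∑ p ∈ antidiagonal N, f p) S :=
  (HasAntidiagonal.sigmaAntidiagonalEquivProd.hasSum_iff.2 hf).sigma fun N =>
    Finset.hasSum (antidiagonal N) f

theorem hasSum_mul_of_summable_norm {f g : ℕ → ℂ} {a b : ℂ} (hf : HasSum f a) (hg : HasSum g b)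
    (hf' : Summable fun m => ‖f m‖) (hg' : Summable fun j => ‖g j‖) :
    HasSum (fun p : ℕ × ℕ => f p.1 * g p.2) (a * b) :=
  hf.mul hg (summable_mul_of_summable_norm hf' hg')

theorem summable_norm_pow_mul {c : ℕ → ℂ} (hc : Summable fun j => ‖c j‖) {z : ℂ} (hz : ‖z‖ ≤ 1) :
    Summable fun j => ‖z ^ j * c j‖ := by
  refine .of_nonneg_of_le (fun _ => norm_nonneg _) (fun j => ?_) hc
  rw [norm_mul, norm_pow]
  exact mul_le_of_le_one_left (norm_nonneg _) (pow_le_one₀ (norm_nonneg _) hz)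

theorem mul_mul_pow_ne_one {β q : ℂ} (hβ : ∀ n : ℕ, 1 ≤ n → β * q ^ n ≠ 1) (k : ℕ) :
    β * q * q ^ k ≠ 1 := by
  rw [mul_assoc, ← pow_succ']
  exact hβ _ k.succ_pos

/-- Euler's expansion of `(b)_∞ / (b)_n = (bq^n)_∞`. -/
theorem hasSum_pow_mul_eulerTerm {b q : ℂ} (hq : ‖q‖ < 1) (hb : ∀ k : ℕ, b * q ^ k ≠ 1) (n : ℕ) :
    HasSum (fun j => (q ^ n) ^ j * eulerTerm b q j) (qPochInf b q / qPoch b q n) := by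
  rw [← qPoch_mul_qPochInf b hq n, mul_div_cancel_left₀ _ (qPoch_ne_zero hb n)]
  exact (hasSum_eulerTerm (b * q ^ n) hq).congr_fun fun j => (eulerTerm_mul b _ q j).symm

/-! ### The series with summand `n β^n q^(n^2)` -/

theorem succ_sq_add_eq_choose_two (n j : ℕ) :
    (n + 1) ^ 2 + (n + 1) * j + (j + j.choose 2) = (n + 1).choose 2 + (n + j + 2).choose 2 := by
  apply Nat.cast_injective (R := ℚ)
  push_cast [Nat.cast_choose_two]
  ring

theorem choose_two_le_sq (n : ℕ) : n.choose 2 ≤ n ^ 2 := by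
  rw [Nat.choose_two_right, sq]
  exact (Nat.div_le_self _ _).trans (Nat.mul_le_mul_left _ (Nat.sub_le _ _))

theorem summable_norm_nat_mul_pow_mul_pow_sq (β : ℂ) {q : ℂ} (hq : ‖q‖ < 1) :
    Summable fun n : ℕ => ‖((n + 1 : ℕ) : ℂ) * β ^ (n + 1) * q ^ ((n + 1) ^ 2) /
      qPoch q q (n + 1)‖ := by
  obtain ⟨C, hC⟩ := exists_norm_inv_qPoch_le hq (mul_pow_ne_one hq hq)
  have hs := ((summable_nat_add_iff 1).2 (summable_pow_mul_pow_choose_two (2 * ‖β‖)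
    (by positivity) (norm_nonneg q) hq)).mul_right C
  refine Summable.of_nonneg_of_le (fun _ => norm_nonneg _) (fun n => ?_) hs
  rw [div_eq_mul_inv, norm_mul, norm_mul, norm_mul, norm_pow, norm_pow, Complex.norm_natCast,
    mul_pow]
  gcongr ?_ * _ * ?_ * ?_
  · exact_mod_cast Nat.lt_two_pow_self.le
  · exact pow_le_pow_of_le_one (norm_nonneg q) hq.le (choose_two_le_sq _)
  · exact hC _

/-- Expanding `1 / (βq)_n` by Euler's formula and collecting equal powers of `β` turns the inner
sums into the `t`-derivative at `1` of the `q`-binomial theorem. -/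
theorem hasSum_nat_mul_pow_mul_pow_sq {β q : ℂ} (hq : ‖q‖ < 1)
    (hβ : ∀ n : ℕ, 1 ≤ n → β * q ^ n ≠ 1) :
    ∃ A : ℂ,
      HasSum (fun n : ℕ => ((n + 1 : ℕ) : ℂ) * β ^ (n + 1) * q ^ ((n + 1) ^ 2) /
        (qPoch (β * q) q (n + 1) * qPoch q q (n + 1))) A ∧
      HasSum (fun n : ℕ => (-β) ^ (n + 1) * q ^ (n + 2).choose 2 / (1 - q ^ (n + 1)))
        (-(qPochInf (β * q) q * A)) := by
  have hb := mul_mul_pow_ne_one hβ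
  have hB := qPochInf_ne_zero hq hb
  set c : ℕ → ℂ := fun n =>
    ((n + 1 : ℕ) : ℂ) * β ^ (n + 1) * q ^ ((n + 1) ^ 2) / qPoch q q (n + 1) with hc
  set f : ℕ × ℕ → ℂ := fun p => c p.1 * ((q ^ (p.1 + 1)) ^ p.2 * eulerTerm (β * q) q p.2) with hf
  have hfs : Summable f := by
    refine Summable.of_norm_bounded ((summable_norm_nat_mul_pow_mul_pow_sq β hq).mul_norm
      (summable_norm_eulerTerm (β * q) hq)) fun p => ?_
    simp only [hf, norm_mul]
    gcongr
    rw [norm_pow, norm_pow]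
    exact mul_le_of_le_one_left (norm_nonneg _)
      (pow_le_one₀ (by positivity) (pow_le_one₀ (norm_nonneg q) hq.le))
  have hrow := hfs.hasSum.prod_fiberwise fun n =>
    (hasSum_pow_mul_eulerTerm hq hb (n + 1)).mul_left (c n)
  have hdiag := hasSum_sum_antidiagonal hfs.hasSum
  refine ⟨(qPochInf (β * q) q)⁻¹ * ∑' p, f p, ?_, ?_⟩
  · refine (hrow.mul_left _).congr_fun fun n => ?_
    have h1 := qPoch_ne_zero hb (n + 1)
    have h2 := qPoch_self_ne_zero hq (n + 1)
    simp only [hc]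
    field_simp
  · rw [mul_inv_cancel_left₀ hB]
    refine hdiag.neg.congr_fun fun N => ?_
    have h := sum_antidiagonal_nat_mul hq N
    rw [Nat.sum_antidiagonal_succ, Nat.cast_zero, zero_mul, zero_div, zero_add] at h
    have e : ∑ p ∈ antidiagonal N, f p = (-β) ^ (N + 1) * q ^ (N + 2).choose 2 *
        (-1 / (1 - q ^ (N + 1))) := by
      rw [← h, mul_sum]
      refine sum_congr rfl fun p hp => ?_
      have h1 := qPoch_self_ne_zero hq (p.1 + 1)
      have h2 := qPoch_self_ne_zero hq p.2
      have hexp := congrArg (q ^ ·) (succ_sq_add_eq_choose_two p.1 p.2)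
      simp only [pow_add _ ((p.1 + 1) ^ 2 + _), pow_add _ ((p.1 + 1) ^ 2),
        pow_add _ ((p.1 + 1).choose 2), pow_add _ p.2] at hexp
      have hsgn : ((-1 : ℂ) ^ (p.1 + 1)) * (-1) ^ (p.1 + 1) = 1 := by
        rw [← mul_pow]; norm_num
      rw [← mem_antidiagonal.1 hp]
      simp only [hf, hc, eulerTerm, ← pow_mul]
      rw [div_mul_eq_mul_div, div_eq_iff h1]
      rw [show (-β) ^ (p.1 + p.2 + 1) = (-1) ^ (p.1 + 1) * β ^ (p.1 + 1) * (-β) ^ p.2 by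
        rw [← mul_pow, neg_one_mul, ← pow_add]; ring_nf]
      rw [← neg_mul, mul_pow]
      field_simp
      linear_combination β ^ (p.1 + 1) * (-β) ^ p.2 * hexp
        - β ^ (p.1 + 1) * (-β) ^ p.2 * q ^ (p.1 + 1).choose 2 *
          q ^ (p.1 + p.2 + 2).choose 2 * hsgn
    rw [e]
    ring

/-! ### The series with summand `(α)_n - (α)_∞` -/

/-- Euler's expansion of `(α)_n / (α)_∞ = 1 / (αq^n)_∞`, without its constant term. -/
theorem hasSum_qPoch_div_sub_one {α q : ℂ} (hα : ‖α‖ < 1) (hq : ‖q‖ < 1) (n : ℕ) :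
    HasSum (fun m => (q ^ n) ^ (m + 1) * eulerInvTerm α q (m + 1))
      (qPoch α q n / qPochInf α q - 1) := by
  have hlt : ‖α * q ^ n‖ < 1 := by
    rw [norm_mul, norm_pow]
    exact mul_lt_one_of_nonneg_of_lt_one_left (norm_nonneg α) hα
      (pow_le_one₀ (norm_nonneg q) hq.le)
  have h := (hasSum_nat_add_iff' 1).2 (hasSum_eulerInvTerm hlt hq)
  rw [sum_range_one, eulerInvTerm, pow_zero, qPoch_zero, div_one] at h
  rw [← qPoch_mul_qPochInf α hq n, div_mul_cancel_left₀ (qPoch_ne_zero (mul_pow_ne_one hq hα) n)]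
  exact h.congr_fun fun m => (eulerInvTerm_mul α _ q (m + 1)).symm

/-- Euler's expansion of `1 / (q^(M+1))_∞`, since `(q)_M (q^(M+1))_∞ = (q)_∞`. -/
theorem hasSum_eulerInvTerm_pow {q : ℂ} (hq : ‖q‖ < 1) (M : ℕ) :
    HasSum (eulerInvTerm (q ^ (M + 1)) q) (qPoch q q M / qPochInf q q) := by
  have hlt : ‖q ^ (M + 1)‖ < 1 := by
    rw [norm_pow]; exact pow_lt_one₀ (norm_nonneg q) hq M.succ_ne_zero
  have h := hasSum_eulerInvTerm hlt hq
  have h1 := qPoch_self_ne_zero hq M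
  rwa [← qPoch_mul_qPochInf q hq M, div_mul_cancel_left₀ h1, ← pow_succ']

/-- The `q`-binomial theorem on the diagonal `N + 1`, with the term of index `(0, N + 1)` moved to
the right-hand side. -/
theorem sum_antidiagonal_qPoch_self_mul {q : ℂ} (hq : ‖q‖ < 1) (α β : ℂ) (N : ℕ) :
    ∑ p ∈ antidiagonal N, qPoch q q (p.1 + p.2) *
        (eulerInvTerm α q (p.1 + 1) * eulerTerm (β * q) q p.2)
      = (∏ k ∈ range (N + 1), (α - β * q ^ (k + 1))) / (1 - q ^ (N + 1))
        - (-β) ^ (N + 1) * q ^ (N + 2).choose 2 / (1 - q ^ (N + 1)) := by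
  have h := sum_antidiagonal_eulerInvTerm_mul_eulerTerm hq α (β * q) (N + 1)
  rw [Nat.sum_antidiagonal_succ, ← eq_sub_iff_add_eq'] at h
  have h1 := qPoch_self_ne_zero hq N
  have h2 := one_sub_pow_succ_ne_zero hq N
  calc _ = qPoch q q N * ∑ p ∈ antidiagonal N,
        eulerInvTerm α q (p.1 + 1) * eulerTerm (β * q) q p.2 := by
        rw [mul_sum]
        exact sum_congr rfl fun p hp => by rw [mem_antidiagonal.1 hp]
    _ = _ := by
        rw [h]
        simp only [mul_assoc, ← pow_succ']
        rw [eulerInvTerm, eulerTerm, qPoch_succ, qPoch_zero, ← pow_succ', choose_two_succ (N + 1),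
          ← neg_mul, mul_pow, pow_add q (N + 1)]
        field_simp

theorem eulerInvTerm_pow (q : ℂ) (M n : ℕ) :
    eulerInvTerm (q ^ M) q n = (q ^ n) ^ M / qPoch q q n := by
  rw [eulerInvTerm, ← pow_mul, ← pow_mul, mul_comm]

/-- The triple-series expansion of the `n`-th term: Euler's two expansions multiplied together. -/
theorem hasSum_qPoch_sub_qPochInf_term {α b q : ℂ} (hα : ‖α‖ < 1) (hq : ‖q‖ < 1)
    (hb : ∀ k : ℕ, b * q ^ k ≠ 1) (n : ℕ) :
    HasSum (fun p : ℕ × ℕ => eulerInvTerm (q ^ (p.1 + p.2 + 1)) q n *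
        (eulerInvTerm α q (p.1 + 1) * eulerTerm b q p.2))
      (qPochInf b q / qPochInf α q *
        (1 / (qPoch b q n * qPoch q q n) * (qPoch α q n - qPochInf α q))) := by
  have hle : ‖q ^ n‖ ≤ 1 := by
    rw [norm_pow]; exact pow_le_one₀ (norm_nonneg q) hq.le
  have h1 := hasSum_qPoch_div_sub_one hα hq n
  have h2 := hasSum_pow_mul_eulerTerm hq hb n
  have hs1 : Summable fun m => ‖(q ^ n) ^ (m + 1) * eulerInvTerm α q (m + 1)‖ :=
    (summable_nat_add_iff 1).2 (summable_norm_pow_mul (summable_norm_eulerInvTerm hα hq) hle)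
  have hs2 := summable_norm_pow_mul (summable_norm_eulerTerm b hq) hle
  have h3 := (hasSum_mul_of_summable_norm h1 h2 hs1 hs2).mul_left (1 / qPoch q q n)
  have e : 1 / qPoch q q n * ((qPoch α q n / qPochInf α q - 1) * (qPochInf b q / qPoch b q n))
      = qPochInf b q / qPochInf α q *
        (1 / (qPoch b q n * qPoch q q n) * (qPoch α q n - qPochInf α q)) := by
    have h4 := qPoch_ne_zero hb n
    have h5 := qPoch_self_ne_zero hq n
    have h6 := qPochInf_ne_zero hq (mul_pow_ne_one hq hα)
    field_simp
  rw [← e]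
  refine h3.congr_fun fun p => ?_
  rw [eulerInvTerm_pow, show p.1 + p.2 + 1 = (p.1 + 1) + p.2 by ring, pow_add]
  ring

/-- The identity in a form uniform in `α`, with `(βq/α)_n α^n` written as `∏ (α - βq^(k+1))`: the
triple series is summed in two orders. -/
theorem hasSum_qPoch_sub_qPochInf_eq {α β q : ℂ} (hα : ‖α‖ < 1) (hq : ‖q‖ < 1)
    (hβ : ∀ n : ℕ, 1 ≤ n → β * q ^ n ≠ 1) :
    ∃ A P : ℂ,
      HasSum (fun n : ℕ => ((n + 1 : ℕ) : ℂ) * β ^ (n + 1) * q ^ ((n + 1) ^ 2) /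
        (qPoch (β * q) q (n + 1) * qPoch q q (n + 1))) A ∧
      HasSum (fun n : ℕ =>
        (∏ k ∈ range (n + 1), (α - β * q ^ (k + 1))) / (1 - q ^ (n + 1))) P ∧
      HasSum (fun n : ℕ =>
        1 / (qPoch (β * q) q n * qPoch q q n) * (qPoch α q n - qPochInf α q))
        (qPochInf α q / qPochInf q q * (A + 1 / qPochInf (β * q) q * P)) := by
  have hb := mul_mul_pow_ne_one hβ
  have hB := qPochInf_ne_zero hq hb
  have hQ := qPochInf_ne_zero hq (mul_pow_ne_one hq hq)
  have hA0 := qPochInf_ne_zero hq (mul_pow_ne_one hq hα)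
  obtain ⟨A, hA, hA'⟩ := hasSum_nat_mul_pow_mul_pow_sq hq hβ
  have hsα := (summable_nat_add_iff 1).2 (summable_norm_eulerInvTerm hα hq)
  have hsβ := summable_norm_eulerTerm (β * q) hq
  set g : ℕ × ℕ → ℂ := fun p => eulerInvTerm α q (p.1 + 1) * eulerTerm (β * q) q p.2 with hg
  set F : ℕ × (ℕ × ℕ) → ℂ := fun x => eulerInvTerm (q ^ (x.2.1 + x.2.2 + 1)) q x.1 * g x.2 with hF
  have hFs : Summable F := by
    refine Summable.of_norm_bounded
      ((summable_norm_eulerInvTerm hq hq).mul_norm (hsα.mul_norm hsβ)) fun x => ?_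
    simp only [hF, hg, norm_mul]
    gcongr
    rw [pow_succ', eulerInvTerm_mul, norm_mul, norm_pow, norm_pow]
    exact mul_le_of_le_one_left (norm_nonneg _)
      (pow_le_one₀ (by positivity) (pow_le_one₀ (norm_nonneg q) hq.le))
  obtain ⟨S, hS⟩ := hFs
  -- Summing over `n` last gives the left-hand side, up to a constant factor.
  have hrow := (hS.prod_fiberwise fun n => hasSum_qPoch_sub_qPochInf_term hα hq hb n).mul_left
    (qPochInf α q / qPochInf (β * q) q)
  -- Summing over `n` first, and then along `m + j = N`, gives the right-hand side.
  have hcol := ((Equiv.prodComm (ℕ × ℕ) ℕ).hasSum_iff.2 hS).prod_fiberwise fun p =>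
    (hasSum_eulerInvTerm_pow hq (p.1 + p.2)).mul_right (g p)
  have hdiag := (hasSum_sum_antidiagonal hcol).mul_left (qPochInf q q)
  have hP : HasSum (fun n : ℕ =>
      (∏ k ∈ range (n + 1), (α - β * q ^ (k + 1))) / (1 - q ^ (n + 1)))
      (qPochInf q q * S + -(qPochInf (β * q) q * A)) := by
    refine (hdiag.add hA').congr_fun fun N => ?_
    rw [← sub_eq_iff_eq_add, ← sum_antidiagonal_qPoch_self_mul hq, mul_sum]
    refine sum_congr rfl fun p _ => ?_
    simp only [hg]
    field_simp
  refine ⟨A, _, hA, hP, ?_⟩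
  have e : qPochInf α q / qPochInf q q * (A + 1 / qPochInf (β * q) q *
      (qPochInf q q * S + -(qPochInf (β * q) q * A)))
      = qPochInf α q / qPochInf (β * q) q * S := by
    field_simp
    ring
  rw [e]
  refine hrow.congr_fun fun n => ?_
  field_simp

/-! ### The homogeneous form of `(βq/α)_n α^n` -/

theorem qPoch_div_mul_pow {α : ℂ} (hα : α ≠ 0) (β q : ℂ) (n : ℕ) :
    qPoch (β * q / α) q n * α ^ n = ∏ k ∈ range n, (α - β * q ^ (k + 1)) := by
  rw [qPoch, ← card_range n, ← prod_const, card_range, ← prod_mul_distrib]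
  refine prod_congr rfl fun k _ => ?_
  rw [pow_succ']
  field_simp

theorem prod_zero_sub_mul_pow (β q : ℂ) (n : ℕ) :
    ∏ k ∈ range n, (0 - β * q ^ (k + 1)) = (-β) ^ n * q ^ ((n + 1) * n / 2) := by
  have h := Nat.choose_two_right (n + 1)
  rw [Nat.add_sub_cancel] at h
  rw [← h]
  clear h
  induction n with
  | zero => simp
  | succ n ih => rw [prod_range_succ, ih, choose_two_succ (n + 1)]; ring

/-! ### The identity -/

theorem theorem1p9 (α β q : ℂ) (hα : ‖α‖ < 1) (hq : ‖q‖ < 1)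
    (hβ : ∀ n : ℕ, 1 ≤ n → β * q ^ n ≠ 1) :
    -- all series converge absolutely; sums over `n ≥ 1` are indexed by `n + 1` with `n : ℕ`
    Summable (fun n : ℕ =>
      1 / (qPoch (β * q) q n * qPoch q q n) * (qPoch α q n - qPochInf α q)) ∧
    Summable (fun n : ℕ =>
      ((n + 1 : ℕ) : ℂ) * β ^ (n + 1) * q ^ ((n + 1) ^ 2) /
        (qPoch (β * q) q (n + 1) * qPoch q q (n + 1))) ∧
    (α ≠ 0 →
      Summable (fun n : ℕ =>
        qPoch (β * q / α) q (n + 1) / (1 - q ^ (n + 1)) * α ^ (n + 1)) ∧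
      ∑' n : ℕ, 1 / (qPoch (β * q) q n * qPoch q q n) * (qPoch α q n - qPochInf α q) =
        qPochInf α q / qPochInf q q *
          ((∑' n : ℕ, ((n + 1 : ℕ) : ℂ) * β ^ (n + 1) * q ^ ((n + 1) ^ 2) /
              (qPoch (β * q) q (n + 1) * qPoch q q (n + 1))) +
            1 / qPochInf (β * q) q *
              ∑' n : ℕ, qPoch (β * q / α) q (n + 1) / (1 - q ^ (n + 1)) * α ^ (n + 1))) ∧
    -- for `α = 0` the factor `(βq/α)_n α^n` is read as its limit `(-β)^n q^(n(n+1)/2)` as `α → 0`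
    (α = 0 →
      Summable (fun n : ℕ =>
        (-β) ^ (n + 1) * q ^ ((n + 1) * (n + 2) / 2) / (1 - q ^ (n + 1))) ∧
      ∑' n : ℕ, 1 / (qPoch (β * q) q n * qPoch q q n) * (qPoch α q n - qPochInf α q) =
        qPochInf α q / qPochInf q q *
          ((∑' n : ℕ, ((n + 1 : ℕ) : ℂ) * β ^ (n + 1) * q ^ ((n + 1) ^ 2) /
              (qPoch (β * q) q (n + 1) * qPoch q q (n + 1))) +
            1 / qPochInf (β * q) q *
              ∑' n : ℕ, (-β) ^ (n + 1) * q ^ ((n + 1) * (n + 2) / 2) / (1 - q ^ (n + 1)))) := by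
  obtain ⟨A, P, hA, hP, hL⟩ := hasSum_qPoch_sub_qPochInf_eq hα hq hβ
  refine ⟨hL.summable, hA.summable, fun h0 => ?_, fun h0 => ?_⟩
  · have hP' : HasSum (fun n : ℕ =>
        qPoch (β * q / α) q (n + 1) / (1 - q ^ (n + 1)) * α ^ (n + 1)) P := by
      simpa only [div_mul_eq_mul_div, qPoch_div_mul_pow h0] using hP
    exact ⟨hP'.summable, by rw [hL.tsum_eq, hA.tsum_eq, hP'.tsum_eq]⟩
  · have hP' : HasSum (fun n : ℕ =>
        (-β) ^ (n + 1) * q ^ ((n + 1) * (n + 2) / 2) / (1 - q ^ (n + 1))) P := by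
      rw [h0] at hP
      simpa only [prod_zero_sub_mul_pow, mul_comm (_ + 1 + 1) (_ + 1)] using hP
    exact ⟨hP'.summable, by rw [hL.tsum_eq, hA.tsum_eq, hP'.tsum_eq]⟩
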